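/- Let $I=[0,1]$ with Lebesgue measure $m$, let $1<p<2$ and $\frac1p+\frac1q=1$. For measurable $f$ on $I$ let $f^*(t)=\inf\{\lambda>0: m(\{|f|>\lambda\})<t\}$ be its decreasing rearrangement. Let ${\rm Exp}\,L^q$ be the Orlicz space with the Luxemburg norm $\|f\|=\inf\{\lambda>0:\int_I (e^{(|f(t)|/\lambda)^q}-1)\,dt\le 1\}$, and let $X_p$ be the Lorentz space of all measurable $f$ with $\|f\|=\big(\int_0^1 (f^*(t))^p\,dW(t)\big)^{1/p}<\infty$, where $W(t)=\ln^{1-p}(e/t)$, $W(0)=0$. For a real sequence $a$ let $a^*(i)$ be the $i$-th largest of the $|a_j|$ and let $\|a\|_{l^{p,\infty}}=\sup_{k\ge 1}k^{\frac1p-1}\sum_{i=1}^k a^*(i)$; finite sequences are extended by zero. Then ${\rm Exp}\,L^q\subset L^1(I)$ and $X_p\subset L^1(I)$, and both inclusions are $(l^{p,\infty},1)$-absolutely summing: for $X={\rm Exp}\,L^q$ and for $X=X_p$ there is a constant $C>0$ such that for every $n$ and all $f_1,\dots,f_n\in X$ $$\big\|(\|f_i\|_{L^1})_{i=1}^n\big\|_{l^{p,\infty}}\le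 C\,\sup_{x^*\in B_{X^*}}\sum_{i=1}^n|\langle x^*,f_i\rangle|,$$ where $B_{X^*}$ is the set of all linear functionals $x^*$ on $X$ with $|\langle x^*,f\rangle|\le\|f\|$ for all $f\in X$. -/

import Mathlib

open MeasureTheory Set
open scoped ENNReal unitInterval

noncomputable section

/-! ### Decreasing rearrangement -/

/-- The decreasing rearrangement `f^*(t) = inf {l > 0 : μ {|f| > l} < t}` of a real function on a
measure space. On `ℕ` with the counting measure and `t = k ≥ 1` an integer, this is the `k`-th
largest absolute value of the sequence. -/
def rearr {Ω : Type*} [MeasurableSpace Ω] (μ : Measure Ω) (f : Ω → ℝ) (t : ℝ≥0∞) : ℝ≥0∞ :=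
  sInf {l : ℝ≥0∞ | 0 < l ∧ μ {x | l < ‖f x‖ₑ} < t}

/-! ### Function spaces on `I = [0, 1]` -/

/-- `L^0 = L^0(I)`: classes of real measurable functions on `I = [0, 1]`, up to equality almost
everywhere for Lebesgue measure. -/
abbrev L0 : Type := I →ₘ[(volume : Measure I)] ℝ

/-- `L^1 = L^1(I)` with its usual norm. -/
abbrev L1 : Type := Lp ℝ 1 (volume : Measure I)

/-- The positive numbers `l` that are admissible in the Luxemburg norm of `f` for `Φ`. -/
def luxemburgSet (Φ : ℝ → ℝ) (f : L0) : Set ℝ :=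
  {l : ℝ | 0 < l ∧ ∫⁻ t : I, ENNReal.ofReal (Φ (|f t| / l)) ≤ 1}

/-- The Luxemburg--Nakano norm. -/
def luxemburgNorm (Φ : ℝ → ℝ) (f : L0) : ℝ := sInf (luxemburgSet Φ f)

/-- The Orlicz space `L_Φ`, for `Φ` nondecreasing and convex on `[0, ∞)` with `Φ 0 = 0`: all
functions for which some number is admissible in the Luxemburg norm. -/
def OrliczSpace (Φ : ℝ → ℝ) (hmono : MonotoneOn Φ (Ici 0)) (hconv : ConvexOn ℝ (Ici 0) Φ)
    (h0 : Φ 0 = 0) : Submodule ℝ L0 where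
  carrier := {f | (luxemburgSet Φ f).Nonempty}
  zero_mem' := by
    refine ⟨1, one_pos, ?_⟩
    have : ∀ᵐ t : I, ENNReal.ofReal (Φ (|(0 : L0) t| / 1)) = 0 := by
      filter_upwards [AEEqFun.coeFn_zero (α := I) (β := ℝ) (μ := volume)] with t ht
      simp [ht, h0]
    rw [lintegral_congr_ae this]
    simp
  add_mem' := by
    rintro f g ⟨a, ha, hfa⟩ ⟨b, hb, hgb⟩
    have hab : 0 < a + b := add_pos ha hb
    refine ⟨a + b, hab, ?_⟩
    have key : ∀ᵐ t : I, ENNReal.ofReal (Φ (|(f + g) t| / (a + b))) ≤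
        ENNReal.ofReal (a / (a + b)) * ENNReal.ofReal (Φ (|f t| / a)) +
        ENNReal.ofReal (b / (a + b)) * ENNReal.ofReal (Φ (|g t| / b)) := by
      filter_upwards [AEEqFun.coeFn_add f g] with t ht
      rw [ht, Pi.add_apply]
      have hx : (0 : ℝ) ≤ |f t| / a := by positivity
      have hy : (0 : ℝ) ≤ |g t| / b := by positivity
      have hΦx : 0 ≤ Φ (|f t| / a) := h0 ▸ hmono (mem_Ici.2 le_rfl) hx hx
      have hΦy : 0 ≤ Φ (|g t| / b) := h0 ▸ hmono (mem_Ici.2 le_rfl) hy hy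
      have hle : |f t + g t| / (a + b) ≤
          (a / (a + b)) • (|f t| / a) + (b / (a + b)) • (|g t| / b) := by
        have e : (a / (a + b)) • (|f t| / a) + (b / (a + b)) • (|g t| / b) =
            (|f t| + |g t|) / (a + b) := by
          simp only [smul_eq_mul]; field_simp
        rw [e]; gcongr; exact abs_add_le _ _
      have h1 := hmono (mem_Ici.2 (by positivity)) (mem_Ici.2 (by positivity)) hle
      have h2 := hconv.2 (mem_Ici.2 hx) (mem_Ici.2 hy) (by positivity : 0 ≤ a / (a + b))
        (by positivity : 0 ≤ b / (a + b)) (by field_simp)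
      rw [← ENNReal.ofReal_mul (by positivity), ← ENNReal.ofReal_mul (by positivity),
        ← ENNReal.ofReal_add (by positivity) (by positivity)]
      exact ENNReal.ofReal_le_ofReal (h1.trans (by simpa only [smul_eq_mul] using h2))
    have hmeas : Measurable fun u : ℝ => ENNReal.ofReal (Φ (|u| / a)) := by
      have hm : Monotone fun u : ℝ => Φ (max u 0) := fun u v huv =>
        hmono (mem_Ici.2 (le_max_right _ _)) (mem_Ici.2 (le_max_right _ _))
          (max_le_max_right 0 huv)
      have he : (fun u : ℝ => ENNReal.ofReal (Φ (|u| / a))) =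
          fun u : ℝ => ENNReal.ofReal (Φ (max (|u| / a) 0)) := by
        funext u
        rw [max_eq_left (by positivity)]
      rw [he]
      exact ENNReal.measurable_ofReal.comp (hm.measurable.comp (by fun_prop))
    have hmf : AEMeasurable (fun t : I =>
        ENNReal.ofReal (a / (a + b)) * ENNReal.ofReal (Φ (|f t| / a))) volume :=
      (hmeas.comp_aemeasurable f.aemeasurable).const_mul _
    calc ∫⁻ t : I, ENNReal.ofReal (Φ (|(f + g) t| / (a + b)))
        ≤ ∫⁻ t : I, (ENNReal.ofReal (a / (a + b)) * ENNReal.ofReal (Φ (|f t| / a)) +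
        ENNReal.ofReal (b / (a + b)) * ENNReal.ofReal (Φ (|g t| / b))) := lintegral_mono_ae key
      _ = ENNReal.ofReal (a / (a + b)) * (∫⁻ t : I, ENNReal.ofReal (Φ (|f t| / a))) +
        ENNReal.ofReal (b / (a + b)) * ∫⁻ t : I, ENNReal.ofReal (Φ (|g t| / b)) := by
          rw [lintegral_add_left' hmf, lintegral_const_mul' _ _ ENNReal.ofReal_ne_top,
            lintegral_const_mul' _ _ ENNReal.ofReal_ne_top]
      _ ≤ ENNReal.ofReal (a / (a + b)) * 1 + ENNReal.ofReal (b / (a + b)) * 1 := by gcongr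
      _ = 1 := by
          rw [mul_one, mul_one, ← ENNReal.ofReal_add (by positivity) (by positivity)]
          rw [← add_div, div_self hab.ne', ENNReal.ofReal_one]
  smul_mem' := by
    rintro c f ⟨a, ha, hfa⟩
    have hc : 0 < |c| + 1 := by positivity
    refine ⟨(|c| + 1) * a, by positivity, le_trans (lintegral_mono_ae ?_) hfa⟩
    filter_upwards [AEEqFun.coeFn_smul c f] with t ht
    rw [ht, Pi.smul_apply, smul_eq_mul, abs_mul]
    refine ENNReal.ofReal_le_ofReal (hmono (mem_Ici.2 (by positivity)) (mem_Ici.2 (by positivity)) ?_)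
    rw [div_le_div_iff₀ (by positivity) ha]
    have : 0 ≤ |f t| * a := by positivity
    nlinarith

/-- The function `N_q(u) = e^{u^q} - 1`. -/
def expYoung (q : ℝ) (u : ℝ) : ℝ := Real.exp (u ^ q) - 1

lemma expYoung_monotoneOn {q : ℝ} (hq : 1 ≤ q) : MonotoneOn (expYoung q) (Ici 0) := by
  intro u hu v _ huv
  have hu' : (0 : ℝ) ≤ u := hu
  unfold expYoung
  gcongr

lemma expYoung_convexOn {q : ℝ} (hq : 1 ≤ q) : ConvexOn ℝ (Ici 0) (expYoung q) := by
  have h := (convexOn_rpow hq)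
  refine ⟨convex_Ici 0, fun u hu v hv a b ha hb hab => ?_⟩
  have h1 := h.2 hu hv ha hb hab
  have h2 := convexOn_exp.2 (mem_univ (u ^ q)) (mem_univ (v ^ q)) ha hb hab
  have h3 := (Real.exp_le_exp.2 h1).trans h2
  simp only [expYoung, smul_eq_mul] at h3 ⊢
  linear_combination h3 + hab

lemma expYoung_zero {q : ℝ} (hq : 1 ≤ q) : expYoung q 0 = 0 := by
  simp [expYoung, Real.zero_rpow (by linarith : q ≠ 0)]

/-- The exponential Orlicz space `Exp L^q`, `1 ≤ q < ∞`. -/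
def ExpL (q : ℝ) (hq : 1 ≤ q) : Submodule ℝ L0 :=
  OrliczSpace (expYoung q) (expYoung_monotoneOn hq) (expYoung_convexOn hq) (expYoung_zero hq)

instance (q : ℝ) (hq : 1 ≤ q) : Norm (ExpL q hq) := ⟨fun f => luxemburgNorm (expYoung q) f⟩

/-! ### The Lorentz space `X_p` -/

/-- The Lorentz functional `‖f‖ = (∫_I (f^*(t))^p dφ(t))^(1/p)`, with values in `[0, ∞]`. -/
def lorentzENorm (p : ℝ) (φ : StieltjesFunction ℝ) (f : L0) : ℝ≥0∞ :=
  (∫⁻ t in Ioc (0 : ℝ) 1, rearr (volume : Measure I) f (ENNReal.ofReal t) ^ p ∂φ.measure) ^ (1 / p)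

/-- The function `W(t) = ln^{1-p}(e/t)` on `(0, 1]`, extended by `W = 0` on `(-∞, 0]` and by
`W = W(1) = 1` on `[1, ∞)`. -/
def lorentzWeightFun (p : ℝ) (t : ℝ) : ℝ :=
  if t ≤ 0 then 0 else Real.log (Real.exp 1 / min t 1) ^ (1 - p)

lemma lorentzWeight_log {t : ℝ} (ht : 0 < t) : 1 ≤ Real.log (Real.exp 1 / min t 1) := by
  have hm : 0 < min t 1 := lt_min ht one_pos
  rw [Real.log_div (Real.exp_pos 1).ne' hm.ne', Real.log_exp]
  linarith [Real.log_nonpos hm.le (min_le_right t 1)]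

/-- `W` as a nondecreasing right-continuous function; its Stieltjes measure is `dW`. -/
def lorentzWeight (p : ℝ) (hp : 1 < p) : StieltjesFunction ℝ where
  toFun := lorentzWeightFun p
  mono' := by
    intro s t hst
    unfold lorentzWeightFun
    by_cases hs : s ≤ 0
    · rw [if_pos hs]
      split_ifs with ht
      · exact le_rfl
      · have := lorentzWeight_log (not_le.1 ht)
        positivity
    · have hs' : 0 < s := not_le.1 hs
      have ht' : 0 < t := hs'.trans_le hst
      rw [if_neg hs, if_neg ht'.not_ge]
      have h1 : 0 < min s 1 := lt_min hs' one_pos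
      refine Real.rpow_le_rpow_of_nonpos (by linarith [lorentzWeight_log ht']) ?_ (by linarith)
      apply Real.log_le_log (by positivity)
      gcongr
  right_continuous' := by
    intro t
    rcases lt_trichotomy t 0 with ht | rfl | ht
    · have : lorentzWeightFun p =ᶠ[nhds t] fun _ => 0 := by
        filter_upwards [Iio_mem_nhds ht] with s hs
        rw [lorentzWeightFun, if_pos (le_of_lt hs)]
      exact (continuousAt_const.congr this.symm).continuousWithinAt
    · rw [← continuousWithinAt_Ioi_iff_Ici]
      have h0 : lorentzWeightFun p 0 = 0 := by simp [lorentzWeightFun]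
      rw [ContinuousWithinAt, h0]
      have hlog : Filter.Tendsto (fun s : ℝ => 1 - Real.log s) (nhdsWithin 0 (Ioi 0))
          Filter.atTop := by
        have := Filter.tendsto_neg_atBot_atTop.comp Real.tendsto_log_nhdsGT_zero
        exact (Filter.tendsto_atTop_add_const_left _ 1 this)
      have hpow := (tendsto_rpow_neg_atTop (by linarith : 0 < p - 1)).comp hlog
      refine hpow.congr' ?_
      filter_upwards [Ioo_mem_nhdsGT (zero_lt_one' ℝ)] with s hs
      have hs0 : 0 < s := hs.1
      rw [lorentzWeightFun, if_neg hs0.not_ge, min_eq_left hs.2.le,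
        Real.log_div (Real.exp_pos 1).ne' hs0.ne', Real.log_exp]
      simp
    · have : (fun s => Real.log (Real.exp 1 / min s 1) ^ (1 - p)) =ᶠ[nhds t]
          lorentzWeightFun p := by
        filter_upwards [Ioi_mem_nhds ht] with s hs
        rw [lorentzWeightFun, if_neg (not_le.2 hs)]
      have hm : 0 < min t 1 := lt_min ht one_pos
      have hl := lorentzWeight_log ht
      refine (ContinuousAt.congr ?_ this).continuousWithinAt
      refine ContinuousAt.rpow_const (ContinuousAt.log ?_ (by positivity)) (Or.inl (by linarith))
      exact continuousAt_const.div (by fun_prop) hm.ne'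

lemma rearr_antitone {Ω : Type*} [MeasurableSpace Ω] (μ : Measure Ω) (f : Ω → ℝ) :
    Antitone (rearr μ f) := fun _ _ hst =>
  sInf_le_sInf fun _ hl => ⟨hl.1, hl.2.trans_le hst⟩

lemma rearr_congr {Ω : Type*} [MeasurableSpace Ω] {μ : Measure Ω} {f g : Ω → ℝ} (h : f =ᵐ[μ] g) :
    rearr μ f = rearr μ g := by
  funext t
  have : ∀ l : ℝ≥0∞, μ {x | l < ‖f x‖ₑ} = μ {x | l < ‖g x‖ₑ} := fun l => by
    apply measure_congr
    filter_upwards [h] with x hx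
    apply propext
    change l < ‖f x‖ₑ ↔ l < ‖g x‖ₑ
    rw [hx]
  simp only [rearr, this]

lemma rearr_zero {Ω : Type*} [MeasurableSpace Ω] (μ : Measure Ω) {t : ℝ≥0∞} (ht : 0 < t) :
    rearr μ (fun _ => 0) t = 0 := by
  refine le_antisymm (le_of_forall_gt fun c hc => ?_) bot_le
  obtain ⟨d, hd0, hdc⟩ := exists_between hc
  have hd : d ∈ {l : ℝ≥0∞ | 0 < l ∧ μ {x | l < ‖(fun _ => (0 : ℝ)) x‖ₑ} < t} :=
    ⟨hd0, by simpa using ht⟩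
  exact (sInf_le hd).trans_lt hdc

lemma rearr_smul_le {Ω : Type*} [MeasurableSpace Ω] (μ : Measure Ω) (c : ℝ) (f : Ω → ℝ)
    {t : ℝ≥0∞} (ht : 0 < t) : rearr μ (c • f) t ≤ ‖c‖ₑ * rearr μ f t := by
  by_cases hc : c = 0
  · subst hc
    have : ((0 : ℝ) • f) = fun _ => 0 := by simp; rfl
    rw [this, rearr_zero μ ht]
    exact bot_le
  have hc0 : ‖c‖ₑ ≠ 0 := by simpa using hc
  have hcT : ‖c‖ₑ ≠ ∞ := enorm_ne_top
  rw [mul_comm, ← ENNReal.div_le_iff hc0 hcT]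
  refine le_sInf fun l hl => ?_
  rw [ENNReal.div_le_iff hc0 hcT]
  refine sInf_le ⟨ENNReal.mul_pos hl.1.ne' hc0, ?_⟩
  convert hl.2 using 3
  ext x
  simp only [Pi.smul_apply, smul_eq_mul, enorm_mul]
  change l * ‖c‖ₑ < ‖c‖ₑ * ‖f x‖ₑ ↔ l < ‖f x‖ₑ
  rw [mul_comm l]
  exact ENNReal.mul_lt_mul_iff_right hc0 hcT

lemma rearr_add_le {Ω : Type*} [MeasurableSpace Ω] (μ : Measure Ω) (f g : Ω → ℝ) (t : ℝ≥0∞) :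
    rearr μ (f + g) t ≤ rearr μ f (t / 2) + rearr μ g (t / 2) := by
  simp only [rearr]
  rw [ENNReal.sInf_add]
  refine le_iInf₂ fun l hl => ?_
  rw [add_comm l, ENNReal.sInf_add]
  refine le_iInf₂ fun m hm => sInf_le ⟨hl.1.trans_le le_add_self, ?_⟩
  calc μ {x | m + l < ‖(f + g) x‖ₑ} ≤ μ ({x | l < ‖f x‖ₑ} ∪ {x | m < ‖g x‖ₑ}) := by
        refine measure_mono fun x hx => ?_
        by_contra hcon
        simp only [mem_union, mem_ofPred_eq, not_or, not_lt] at hcon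
        have h1 : ‖(f + g) x‖ₑ ≤ l + m := (enorm_add_le _ _).trans (add_le_add hcon.1 hcon.2)
        rw [add_comm l m] at h1
        exact absurd hx (not_lt.2 h1)
    _ ≤ μ {x | l < ‖f x‖ₑ} + μ {x | m < ‖g x‖ₑ} := measure_union_le _ _
    _ < t / 2 + t / 2 := ENNReal.add_lt_add hl.2 hm.2
    _ = t := ENNReal.add_halves t

lemma lorentzWeight_four {p : ℝ} (hp : 1 < p) {a : ℝ} (ha : 0 < a) :
    lorentzWeightFun p (4 * a) ≤ (1 + Real.log 4) ^ (p - 1) * lorentzWeightFun p a := by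
  have h4a : 0 < 4 * a := by linarith
  rw [lorentzWeightFun, lorentzWeightFun, if_neg ha.not_ge, if_neg h4a.not_ge]
  set M := Real.log (Real.exp 1 / min (4 * a) 1) with hM
  set L := Real.log (Real.exp 1 / min a 1) with hL
  have hM1 : 1 ≤ M := lorentzWeight_log h4a
  have hL1 : 1 ≤ L := lorentzWeight_log ha
  have hlog4 : 0 < Real.log 4 := Real.log_pos (by norm_num)
  have hLM : L ≤ M + Real.log 4 := by
    have hm : 0 < min a 1 := lt_min ha one_pos
    have hm4 : 0 < min (4 * a) 1 := lt_min h4a one_pos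
    rw [hM, ← Real.log_mul (by positivity) (by norm_num)]
    apply Real.log_le_log (by positivity)
    rw [div_mul_eq_mul_div, div_le_div_iff₀ hm hm4, mul_assoc]
    gcongr
    rcases le_total a 1 with h | h
    · rw [min_eq_left h]; exact min_le_left _ _
    · rw [min_eq_right h]; exact (min_le_right _ _).trans (by norm_num)
  have hLK : L ≤ (1 + Real.log 4) * M := by nlinarith
  have h1 : ((1 + Real.log 4) * M) ^ (1 - p) ≤ L ^ (1 - p) :=
    Real.rpow_le_rpow_of_nonpos (by linarith) hLK (by linarith)
  rw [Real.mul_rpow (by positivity) (by linarith)] at h1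
  have h2 : (1 + Real.log 4) ^ (p - 1) * (1 + Real.log 4) ^ (1 - p) = 1 := by
    rw [← Real.rpow_add (by positivity)]; simp
  calc M ^ (1 - p) = (1 + Real.log 4) ^ (p - 1) * ((1 + Real.log 4) ^ (1 - p) * M ^ (1 - p)) := by
        rw [← mul_assoc, h2, one_mul]
    _ ≤ _ := by gcongr

lemma lorentzWeight_meas_half {p : ℝ} (hp : 1 < p) {A : Set ℝ}
    (hA : ∀ s ∈ A, ∀ t, 0 < t → t ≤ s → t ∈ A) :
    (lorentzWeight p hp).measure {t | t ∈ Ioc (0 : ℝ) 1 ∧ t / 2 ∈ A} ≤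
      ENNReal.ofReal ((1 + Real.log 4) ^ (p - 1)) *
        (lorentzWeight p hp).measure (A ∩ Ioc (0 : ℝ) 1) := by
  set B := {t | t ∈ Ioc (0 : ℝ) 1 ∧ t / 2 ∈ A} with hB
  rcases B.eq_empty_or_nonempty with h | ⟨b₀, hb₀⟩
  · rw [h]; simp
  have hbdd : BddAbove B := ⟨1, fun t ht => ht.1.2⟩
  have hS : 0 < sSup B := hb₀.1.1.trans_le (le_csSup hbdd hb₀)
  obtain ⟨b, hb, hlt⟩ := exists_lt_of_lt_csSup ⟨b₀, hb₀⟩ (half_lt_self hS)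
  have hb0 : 0 < b := hb.1.1
  have hz : (lorentzWeight p hp) 0 = 0 := by
    change lorentzWeightFun p 0 = 0
    simp [lorentzWeightFun]
  calc (lorentzWeight p hp).measure B ≤ (lorentzWeight p hp).measure (Ioc 0 (4 * (b / 2))) := by
        refine measure_mono fun t ht => ⟨ht.1.1, ?_⟩
        linarith [le_csSup hbdd ht]
    _ ≤ ENNReal.ofReal ((1 + Real.log 4) ^ (p - 1)) *
        (lorentzWeight p hp).measure (Ioc 0 (b / 2)) := by
        have hlog4 : 0 < Real.log 4 := Real.log_pos (by norm_num)
        rw [StieltjesFunction.measure_Ioc, StieltjesFunction.measure_Ioc, hz, sub_zero, sub_zero,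
          ← ENNReal.ofReal_mul (by positivity)]
        exact ENNReal.ofReal_le_ofReal (lorentzWeight_four hp (by linarith))
    _ ≤ _ := by
        gcongr
        intro t ht
        exact ⟨hA _ hb.2 t ht.1 ht.2, ht.1, by linarith [ht.2, hb.1.2]⟩

lemma lorentzWeight_lintegral_half {p : ℝ} (hp : 1 < p) {g : ℝ → ℝ≥0∞} (hg : Antitone g)
    (hfin : ∫⁻ t in Ioc (0 : ℝ) 1, g t ∂(lorentzWeight p hp).measure ≠ ∞)
    (hgfin : ∀ t, 0 < t → g t ≠ ∞) :
    ∫⁻ t in Ioc (0 : ℝ) 1, g (t / 2) ∂(lorentzWeight p hp).measure ≠ ∞ := by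
  set μ := (lorentzWeight p hp).measure
  have hg2 : Antitone fun t : ℝ => g (t / 2) := fun s t hst => hg (by linarith)
  have layer : ∀ h : ℝ → ℝ≥0∞, Antitone h → (∀ t, 0 < t → h t ≠ ∞) →
      ∫⁻ t in Ioc (0 : ℝ) 1, h t ∂μ =
        ∫⁻ l in Ioi (0 : ℝ), μ {t | t ∈ Ioc (0 : ℝ) 1 ∧ l < (h t).toReal} := by
    intro h hh hhf
    have e : ∫⁻ t in Ioc (0 : ℝ) 1, h t ∂μ =
        ∫⁻ t in Ioc (0 : ℝ) 1, ENNReal.ofReal (h t).toReal ∂μ :=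
      setLIntegral_congr_fun measurableSet_Ioc fun t ht => (ENNReal.ofReal_toReal (hhf t ht.1)).symm
    rw [e, lintegral_eq_lintegral_meas_lt _ (Filter.Eventually.of_forall fun _ => ENNReal.toReal_nonneg)
      hh.measurable.ennreal_toReal.aemeasurable]
    refine lintegral_congr fun l => ?_
    rw [Measure.restrict_apply (measurableSet_lt measurable_const hh.measurable.ennreal_toReal)]
    congr 1
    ext t
    simp [and_comm]
  rw [layer _ hg2 fun t ht => hgfin _ (by linarith)]
  rw [layer _ hg hgfin] at hfin
  refine ne_top_of_le_ne_top
    (ENNReal.mul_ne_top (ENNReal.ofReal_ne_top (r := (1 + Real.log 4) ^ (p - 1))) hfin) ?_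
  rw [← lintegral_const_mul' _ _ ENNReal.ofReal_ne_top]
  refine setLIntegral_mono' measurableSet_Ioi fun l _ => ?_
  have := lorentzWeight_meas_half hp (A := {t | 0 < t ∧ l < (g t).toReal})
    fun s hs t ht hts => ⟨ht, hs.2.trans_le
      (ENNReal.toReal_mono (hgfin t ht) (hg hts))⟩
  refine le_trans (measure_mono ?_) (this.trans ?_)
  · exact fun t ht => ⟨ht.1, half_pos ht.1.1, ht.2⟩
  · gcongr
    exact fun t ht => ⟨ht.2, ht.1.2⟩

lemma rearr_ne_top (f : L0) {t : ℝ≥0∞} (ht : 0 < t) : rearr (volume : Measure I) f t ≠ ∞ := by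
  have hlim : Filter.Tendsto (fun n : ℕ => (volume : Measure I) {x | (n : ℝ≥0∞) < ‖f x‖ₑ})
      Filter.atTop (nhds 0) := by
    have hempty : ⋂ n : ℕ, {x : I | (n : ℝ≥0∞) < ‖f x‖ₑ} = ∅ := by
      ext x
      simp only [mem_iInter, mem_ofPred_eq, mem_empty_iff_false, iff_false, not_forall, not_lt]
      obtain ⟨n, hn⟩ := ENNReal.exists_nat_gt (enorm_ne_top (x := f x))
      exact ⟨n, hn.le⟩
    have := tendsto_measure_iInter_atTop (μ := (volume : Measure I))
      (s := fun n : ℕ => {x : I | (n : ℝ≥0∞) < ‖f x‖ₑ})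
      (fun n => (measurableSet_lt measurable_const f.measurable.enorm).nullMeasurableSet)
      (fun m n hmn x (hx : (n : ℝ≥0∞) < ‖f x‖ₑ) =>
        show (m : ℝ≥0∞) < ‖f x‖ₑ from lt_of_le_of_lt (by exact_mod_cast hmn) hx) ⟨0, measure_ne_top _ _⟩
    rwa [hempty, measure_empty] at this
  obtain ⟨n, hn1, hn2⟩ := ((hlim.eventually_lt_const ht).and (Filter.eventually_gt_atTop 0)).exists
  exact ne_top_of_le_ne_top (ENNReal.natCast_ne_top n)
    (sInf_le ⟨by exact_mod_cast hn2, hn1⟩)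

lemma lorentzENorm_ne_top_iff {p : ℝ} (hp : 1 < p) (φ : StieltjesFunction ℝ) (f : L0) :
    lorentzENorm p φ f ≠ ∞ ↔
      ∫⁻ t in Ioc (0 : ℝ) 1, rearr (volume : Measure I) f (ENNReal.ofReal t) ^ p ∂φ.measure ≠ ∞ := by
  have : 0 < 1 / p := by positivity
  rw [lorentzENorm, not_iff_not, ENNReal.rpow_eq_top_iff_of_pos this]

/-- The Lorentz space `X_p = Λ_{p,W}` with `W(t) = ln^{1-p}(e/t)`. -/
def XSpace (p : ℝ) (hp : 1 < p) : Submodule ℝ L0 where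
  carrier := {f | lorentzENorm p (lorentzWeight p hp) f ≠ ∞}
  zero_mem' := by
    change lorentzENorm p (lorentzWeight p hp) 0 ≠ ∞
    rw [lorentzENorm_ne_top_iff hp, rearr_congr AEEqFun.coeFn_zero]
    have : ∫⁻ t in Ioc (0 : ℝ) 1, rearr (volume : Measure I) (0 : I → ℝ) (ENNReal.ofReal t) ^ p
        ∂(lorentzWeight p hp).measure = ∫⁻ t in Ioc (0 : ℝ) 1, 0 ∂(lorentzWeight p hp).measure := by
      refine setLIntegral_congr_fun measurableSet_Ioc fun t ht => ?_
      have h0 : rearr (volume : Measure I) (0 : I → ℝ) (ENNReal.ofReal t) = 0 :=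
        rearr_zero _ (ENNReal.ofReal_pos.2 ht.1)
      simp only [h0]
      exact ENNReal.zero_rpow_of_pos (by linarith)
    rw [this]
    simp
  add_mem' := by
    intro f g hf hg
    change lorentzENorm p (lorentzWeight p hp) f ≠ ∞ at hf
    change lorentzENorm p (lorentzWeight p hp) g ≠ ∞ at hg
    change lorentzENorm p (lorentzWeight p hp) (f + g) ≠ ∞
    rw [lorentzENorm_ne_top_iff hp] at hf hg ⊢
    rw [rearr_congr (AEEqFun.coeFn_add f g)]
    have hanti : ∀ h : L0, Antitone fun t : ℝ =>
        rearr (volume : Measure I) h (ENNReal.ofReal t) ^ p := fun h s t hst =>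
      ENNReal.rpow_le_rpow (rearr_antitone _ _ (ENNReal.ofReal_le_ofReal hst)) (by linarith)
    have htop : ∀ h : L0, ∀ t : ℝ, 0 < t →
        rearr (volume : Measure I) h (ENNReal.ofReal t) ^ p ≠ ∞ := fun h t ht =>
      ENNReal.rpow_ne_top_of_nonneg (by linarith) (rearr_ne_top h (ENNReal.ofReal_pos.2 ht))
    have hf2 := lorentzWeight_lintegral_half hp (hanti f) hf (htop f)
    have hg2 := lorentzWeight_lintegral_half hp (hanti g) hg (htop g)
    refine ne_top_of_le_ne_top (ENNReal.mul_ne_top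
      (ENNReal.rpow_ne_top_of_nonneg (by linarith : 0 ≤ p - 1) (ENNReal.ofNat_ne_top (n := 2)))
      (ENNReal.add_ne_top.2 ⟨hf2, hg2⟩)) ?_
    have hmeas : Measurable fun t : ℝ =>
        rearr (volume : Measure I) f (ENNReal.ofReal (t / 2)) ^ p :=
      Antitone.measurable fun s t hst => hanti f (by linarith)
    rw [← lintegral_add_left hmeas, ← lintegral_const_mul' _ _
      (ENNReal.rpow_ne_top_of_nonneg (by linarith : 0 ≤ p - 1) (ENNReal.ofNat_ne_top (n := 2)))]
    refine lintegral_mono fun t => ?_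
    have h2 : ENNReal.ofReal (t / 2) = ENNReal.ofReal t / 2 := by
      rw [ENNReal.ofReal_div_of_pos two_pos, ENNReal.ofReal_ofNat]
    simp only [h2]
    exact (ENNReal.rpow_le_rpow (rearr_add_le _ _ _ _) (by linarith)).trans
      (ENNReal.rpow_add_le_mul_rpow_add_rpow _ _ hp.le)
  smul_mem' := by
    intro c f hf
    change lorentzENorm p (lorentzWeight p hp) f ≠ ∞ at hf
    change lorentzENorm p (lorentzWeight p hp) (c • f) ≠ ∞
    rw [lorentzENorm_ne_top_iff hp] at hf ⊢
    rw [rearr_congr (AEEqFun.coeFn_smul c f)]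
    have hc : ‖c‖ₑ ^ p ≠ ∞ := ENNReal.rpow_ne_top_of_nonneg (by linarith) enorm_ne_top
    refine ne_top_of_le_ne_top (ENNReal.mul_ne_top hc hf) ?_
    rw [← lintegral_const_mul' _ _ hc]
    refine setLIntegral_mono' measurableSet_Ioc fun t ht => ?_
    rw [← ENNReal.mul_rpow_of_nonneg _ _ (by linarith)]
    exact ENNReal.rpow_le_rpow (rearr_smul_le _ c f (ENNReal.ofReal_pos.2 ht.1)) (by linarith)

/-- The Lorentz functional on `X_p`. (`W` is concave only near `0`, so this is a quasi-norm, which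
is equivalent to a norm.) -/
instance (p : ℝ) (hp : 1 < p) : Norm (XSpace p hp) :=
  ⟨fun f => (lorentzENorm p (lorentzWeight p hp) f).toReal⟩

/-! ### Absolutely summing operators -/

/-- The unit ball of the dual of `X`: linear functionals with `|φ x| ≤ ‖x‖` for all `x`. It is
formulated so that it makes sense also when the norm of `X` is replaced by a quasi-norm. -/
def dualBall (X : Type*) [AddCommGroup X] [Module ℝ X] [Norm X] : Set (X →ₗ[ℝ] ℝ) :=
  {φ | ∀ x, |φ x| ≤ ‖x‖}

/-- The norm `sup_{k ≥ 1} k^(1/p - 1) ∑_{i ≤ k} a^*(i)` of the sequence space `l^{p,∞}`,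
`1 < p < ∞`, with values in `[0, ∞]`. -/
def weakLpNorm (p : ℝ) (a : ℕ → ℝ) : ℝ≥0∞ :=
  ⨆ k : ℕ, ⨆ _ : 1 ≤ k,
    (k : ℝ≥0∞) ^ (1 / p - 1) * ∑ i ∈ Finset.Icc 1 k, rearr (Measure.count : Measure ℕ) a (i : ℝ≥0∞)

/-- `(E, r)`-absolutely summing linear operators `T : X → Y`, where the sequence space `E` is given
by its norm (with values in `[0, ∞]`) and a finite sequence is extended by zero. -/
def IsAbsSumming (E : (ℕ → ℝ) → ℝ≥0∞) (r : ℝ) {X Y : Type*} [AddCommGroup X] [Module ℝ X] [Norm X]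
    [NormedAddCommGroup Y] [NormedSpace ℝ Y] (T : X →ₗ[ℝ] Y) : Prop :=
  ∃ C : ℝ, 0 < C ∧ ∀ (n : ℕ) (x : ℕ → X),
    E (fun i => if i < n then ‖T (x i)‖ else 0) ≤
      ENNReal.ofReal C * ⨆ φ ∈ dualBall X,
        ENNReal.ofReal ((∑ i ∈ Finset.range n, |φ (x i)| ^ r) ^ (1 / r))

end

/-!
For `X = Exp L^q`, let `w` be the supremum over the dual ball of `∑ |φ (f i)|`. By Hahn--Banach
(`ExpL.exists_dualBall_eq_norm`) every signed sum of the `f i`, over any set `A` of indices, has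
Luxemburg norm at most `w`. Pointwise, `∑_{i ∈ A} |f i|` is the largest of these `2^|A|` signed
sums, so that `∫ N_q(∑_{i ∈ A} |f i| / l) ≤ 2^|A|` for every `l > w`. Because `N_q` grows like
`e^{u^q}`, this forces `∑_{i ∈ A} ‖f i‖_1 ≤ 4 w k^{1/q}` whenever `|A| ≤ k`
(`sum_lintegral_enorm_le`). As `1/p - 1 = -1/q`, and as `∑_{i ≤ k} a^*(i)` is at most the sum of
`|a|` over some `k` indices (`exists_sum_rearr_count_le`), this is the claim.

For `X = X_p` it suffices that `X_p` embeds boundedly in `Exp L^q` (`XSpace.norm_inclusion_le`),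
since the summing property is inherited by compositions (`IsAbsSumming.comp`). By monotonicity
`f^*(t)^p W(t) ≤ ‖f‖^p`, that is `f^*(t) ≤ ‖f‖ ln^{1/q}(e/t)`. Hence, for `N > ‖f‖`, the
function `V = (|f| / N)^q` has the tail `m {V > L} ≤ e^{1 - L}`, and `V / 4` is exponentially
integrable.
-/

/-! ### The Luxemburg norm -/

section Luxemburg

variable {Φ : ℝ → ℝ}

lemma measurable_young (hmono : MonotoneOn Φ (Ici 0)) {a : ℝ} (ha : 0 < a) :
    Measurable fun u : ℝ => ENNReal.ofReal (Φ (|u| / a)) := by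
  have hm : Monotone fun u : ℝ => Φ (max u 0) := fun u v huv =>
    hmono (mem_Ici.2 (le_max_right _ _)) (mem_Ici.2 (le_max_right _ _)) (max_le_max_right 0 huv)
  have he : (fun u : ℝ => ENNReal.ofReal (Φ (|u| / a))) =
      fun u : ℝ => ENNReal.ofReal (Φ (max (|u| / a) 0)) := by
    funext u
    rw [max_eq_left (by positivity)]
  rw [he]
  exact ENNReal.measurable_ofReal.comp (hm.measurable.comp (by fun_prop))

lemma luxemburgNorm_nonneg (f : L0) : 0 ≤ luxemburgNorm Φ f :=
  Real.sInf_nonneg fun _ hl => hl.1.le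

lemma luxemburgNorm_le {f : L0} {l : ℝ} (hl : l ∈ luxemburgSet Φ f) : luxemburgNorm Φ f ≤ l :=
  csInf_le ⟨0, fun _ h => h.1.le⟩ hl

lemma mem_luxemburgSet_of_lt (hmono : MonotoneOn Φ (Ici 0)) {f : L0}
    (hf : (luxemburgSet Φ f).Nonempty) {l : ℝ} (hl : luxemburgNorm Φ f < l) :
    l ∈ luxemburgSet Φ f := by
  obtain ⟨a, ⟨ha, hfa⟩, hal⟩ := exists_lt_of_csInf_lt hf hl
  refine ⟨ha.trans hal, le_trans (lintegral_mono fun t => ENNReal.ofReal_le_ofReal ?_) hfa⟩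
  have hl0 : 0 < l := ha.trans hal
  exact hmono (mem_Ici.2 (by positivity)) (mem_Ici.2 (by positivity)) (by gcongr)

lemma add_mem_luxemburgSet (hmono : MonotoneOn Φ (Ici 0)) (hconv : ConvexOn ℝ (Ici 0) Φ)
    (h0 : Φ 0 = 0) {f g : L0} {a b : ℝ} (hf : a ∈ luxemburgSet Φ f) (hg : b ∈ luxemburgSet Φ g) :
    a + b ∈ luxemburgSet Φ (f + g) := by
  obtain ⟨ha, hfa⟩ := hf
  obtain ⟨hb, hgb⟩ := hg
  have hab : 0 < a + b := add_pos ha hb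
  have hnn : ∀ x, 0 ≤ x → 0 ≤ Φ x := fun x hx => h0 ▸ hmono (mem_Ici.2 le_rfl) hx hx
  refine ⟨hab, ?_⟩
  have key : ∀ᵐ t : I, ENNReal.ofReal (Φ (|(f + g) t| / (a + b))) ≤
      ENNReal.ofReal (a / (a + b)) * ENNReal.ofReal (Φ (|f t| / a)) +
      ENNReal.ofReal (b / (a + b)) * ENNReal.ofReal (Φ (|g t| / b)) := by
    filter_upwards [AEEqFun.coeFn_add f g] with t ht
    rw [ht, Pi.add_apply]
    have hx : (0 : ℝ) ≤ |f t| / a := by positivity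
    have hy : (0 : ℝ) ≤ |g t| / b := by positivity
    have hΦx := hnn _ hx
    have hΦy := hnn _ hy
    have hle : |f t + g t| / (a + b) ≤
        (a / (a + b)) • (|f t| / a) + (b / (a + b)) • (|g t| / b) := by
      have e : (a / (a + b)) • (|f t| / a) + (b / (a + b)) • (|g t| / b) =
          (|f t| + |g t|) / (a + b) := by
        simp only [smul_eq_mul]; field_simp
      rw [e]; gcongr; exact abs_add_le _ _
    have h1 := hmono (mem_Ici.2 (by positivity)) (mem_Ici.2 (by positivity)) hle
    have h2 := hconv.2 (mem_Ici.2 hx) (mem_Ici.2 hy) (by positivity : 0 ≤ a / (a + b))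
      (by positivity : 0 ≤ b / (a + b)) (by field_simp)
    rw [← ENNReal.ofReal_mul (by positivity), ← ENNReal.ofReal_mul (by positivity),
      ← ENNReal.ofReal_add (by positivity) (by positivity)]
    exact ENNReal.ofReal_le_ofReal (h1.trans (by simpa only [smul_eq_mul] using h2))
  have hmf : AEMeasurable (fun t : I =>
      ENNReal.ofReal (a / (a + b)) * ENNReal.ofReal (Φ (|f t| / a))) volume :=
    ((measurable_young hmono ha).comp_aemeasurable f.aemeasurable).const_mul _
  calc ∫⁻ t : I, ENNReal.ofReal (Φ (|(f + g) t| / (a + b)))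
      ≤ ∫⁻ t : I, (ENNReal.ofReal (a / (a + b)) * ENNReal.ofReal (Φ (|f t| / a)) +
      ENNReal.ofReal (b / (a + b)) * ENNReal.ofReal (Φ (|g t| / b))) := lintegral_mono_ae key
    _ = ENNReal.ofReal (a / (a + b)) * (∫⁻ t : I, ENNReal.ofReal (Φ (|f t| / a))) +
      ENNReal.ofReal (b / (a + b)) * ∫⁻ t : I, ENNReal.ofReal (Φ (|g t| / b)) := by
        rw [lintegral_add_left' hmf, lintegral_const_mul' _ _ ENNReal.ofReal_ne_top,
          lintegral_const_mul' _ _ ENNReal.ofReal_ne_top]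
    _ ≤ ENNReal.ofReal (a / (a + b)) * 1 + ENNReal.ofReal (b / (a + b)) * 1 := by gcongr
    _ = 1 := by
        rw [mul_one, mul_one, ← ENNReal.ofReal_add (by positivity) (by positivity),
          ← add_div, div_self hab.ne', ENNReal.ofReal_one]

lemma luxemburgNorm_add_le (hmono : MonotoneOn Φ (Ici 0)) (hconv : ConvexOn ℝ (Ici 0) Φ)
    (h0 : Φ 0 = 0) {f g : L0} (hf : (luxemburgSet Φ f).Nonempty)
    (hg : (luxemburgSet Φ g).Nonempty) :
    luxemburgNorm Φ (f + g) ≤ luxemburgNorm Φ f + luxemburgNorm Φ g := by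
  refine le_of_forall_pos_le_add fun ε hε => ?_
  have := luxemburgNorm_le (add_mem_luxemburgSet hmono hconv h0
    (mem_luxemburgSet_of_lt hmono hf (lt_add_of_pos_right _ (half_pos hε)))
    (mem_luxemburgSet_of_lt hmono hg (lt_add_of_pos_right _ (half_pos hε))))
  linarith

lemma luxemburgNorm_smul_le (f : L0) (hf : (luxemburgSet Φ f).Nonempty) {c : ℝ} (hc : c ≠ 0) :
    luxemburgNorm Φ (c • f) ≤ |c| * luxemburgNorm Φ f := by
  have hc' : 0 < |c| := abs_pos.2 hc
  rw [mul_comm, ← div_le_iff₀ hc']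
  refine le_csInf hf fun l hl => ?_
  rw [div_le_iff₀ hc']
  refine luxemburgNorm_le ⟨mul_pos hl.1 hc', le_of_eq_of_le (lintegral_congr_ae ?_) hl.2⟩
  filter_upwards [AEEqFun.coeFn_smul c f] with t ht
  rw [ht, Pi.smul_apply, smul_eq_mul, abs_mul, mul_comm, mul_div_mul_right _ _ hc'.ne']

end Luxemburg

/-! ### Norming functionals -/

namespace ExpL

variable {q : ℝ} {hq : 1 ≤ q}

lemma norm_nonneg (f : ExpL q hq) : 0 ≤ ‖f‖ := luxemburgNorm_nonneg _

lemma norm_add_le (f g : ExpL q hq) : ‖f + g‖ ≤ ‖f‖ + ‖g‖ :=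
  luxemburgNorm_add_le (expYoung_monotoneOn hq) (expYoung_convexOn hq) (expYoung_zero hq)
    f.2 g.2

lemma norm_smul (c : ℝ) (hc : c ≠ 0) (f : ExpL q hq) : ‖c • f‖ = |c| * ‖f‖ := by
  refine le_antisymm (luxemburgNorm_smul_le _ f.2 hc) ?_
  have h : ‖c⁻¹ • (c • f)‖ ≤ |c⁻¹| * ‖c • f‖ :=
    luxemburgNorm_smul_le _ (c • f).2 (inv_ne_zero hc)
  rw [inv_smul_smul₀ hc, abs_inv] at h
  rwa [inv_mul_eq_div, le_div_iff₀ (abs_pos.2 hc), mul_comm] at h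

/-- Hahn--Banach for `Exp L^q`: the dual ball, which is symmetric, norms every element. -/
lemma exists_dualBall_eq_norm (g : ExpL q hq) :
    ∃ φ ∈ dualBall (ExpL q hq), ‖g‖ ≤ φ g := by
  have hom : ∀ c : ℝ, 0 < c → ∀ x : ExpL q hq, ‖c • x‖ = c * ‖x‖ := fun c hc x => by
    rw [norm_smul c hc.ne', abs_of_pos hc]
  have hzero : ‖(0 : ExpL q hq)‖ = 0 := by
    have := hom 2 two_pos 0
    rw [smul_zero] at this
    linarith
  have bound : ∀ φ : ExpL q hq →ₗ[ℝ] ℝ, (∀ x, φ x ≤ ‖x‖) → φ ∈ dualBall (ExpL q hq) := by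
    refine fun φ h x => abs_le'.2 ⟨h x, ?_⟩
    have h1 := h ((-1 : ℝ) • x)
    rw [norm_smul _ (by norm_num), map_smul] at h1
    simpa using h1
  by_cases hg : g = 0
  · exact ⟨0, bound _ fun x => by simpa using norm_nonneg x, by simp [hg, hzero]⟩
  obtain ⟨φ, h1, h2⟩ := exists_extension_of_le_sublinear
    (LinearPMap.mkSpanSingleton g ‖g‖ hg : ExpL q hq →ₗ.[ℝ] ℝ) (fun x => ‖x‖) hom norm_add_le (by
      rintro ⟨x, hx⟩
      obtain ⟨c, rfl⟩ := Submodule.mem_span_singleton.1 hx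
      rw [LinearPMap.mkSpanSingleton'_apply, RingHom.id_apply]
      by_cases hc : c = 0
      · simp [hc, hzero]
      · rw [norm_smul c hc, smul_eq_mul]
        exact mul_le_mul_of_nonneg_right (le_abs_self c) (norm_nonneg g))
  refine ⟨φ, bound φ h2, ?_⟩
  have h3 := h1 ⟨g, Submodule.mem_span_singleton_self g⟩
  exact (h3.trans (LinearPMap.mkSpanSingleton_apply ℝ ℝ hg ‖g‖)).ge

end ExpL

/-! ### Rearrangements of sequences -/

/-- Since `a^*(k + 1)` is at most the maximum of `|a|` off any set of `k` indices, the set `A` can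
be built greedily. -/
lemma exists_sum_rearr_count_le (a : ℕ → ℝ) (n : ℕ) (ha : ∀ i, n ≤ i → a i = 0) (k : ℕ) :
    ∃ A ⊆ Finset.range n, A.card ≤ k ∧
      ∑ i ∈ Finset.Icc 1 k, rearr (Measure.count : Measure ℕ) a (i : ℝ≥0∞) ≤
        ∑ i ∈ A, ‖a i‖ₑ := by
  induction k with
  | zero => exact ⟨∅, by simp⟩
  | succ k ih =>
    obtain ⟨A, hAn, hAk, hA⟩ := ih
    have key : ∀ c : ℝ≥0∞, (∀ i ∉ A, ‖a i‖ₑ ≤ c) →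
        rearr (Measure.count : Measure ℕ) a ((k + 1 : ℕ) : ℝ≥0∞) ≤ c := by
      refine fun c hc => le_of_forall_gt fun d hd => ?_
      obtain ⟨e, he1, he2⟩ := exists_between hd
      refine lt_of_le_of_lt (sInf_le ⟨bot_le.trans_lt he1, ?_⟩) he2
      calc Measure.count {x | e < ‖a x‖ₑ} ≤ Measure.count (A : Set ℕ) := by
            refine measure_mono fun x hx => ?_
            by_contra hxA
            exact absurd (hc x hxA) (not_le.2 (he1.trans hx))
        _ = (A.card : ℝ≥0∞) := Measure.count_apply_finset A
        _ < ((k + 1 : ℕ) : ℝ≥0∞) := by exact_mod_cast Nat.lt_succ_of_le hAk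
    rw [Finset.sum_Icc_succ_top (by omega)]
    rcases (Finset.range n \ A).eq_empty_or_nonempty with h | h
    · refine ⟨A, hAn, by omega, ?_⟩
      rw [show rearr (Measure.count : Measure ℕ) a ((k + 1 : ℕ) : ℝ≥0∞) = 0 from ?_, add_zero]
      · exact hA
      · refine le_antisymm (key 0 fun i hi => ?_) bot_le
        have hin : n ≤ i := by
          by_contra hlt
          have hm : i ∈ Finset.range n \ A := by simp [hi]; omega
          simp [h] at hm
        simp [ha i hin]
    · obtain ⟨j, hj, hmax⟩ := Finset.exists_max_image _ (fun i => ‖a i‖ₑ) h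
      obtain ⟨hjn, hjA⟩ := Finset.mem_sdiff.1 hj
      refine ⟨insert j A, Finset.insert_subset hjn hAn,
        (Finset.card_insert_le _ _).trans (by omega), ?_⟩
      rw [Finset.sum_insert hjA, add_comm]
      refine add_le_add (key _ fun i hi => ?_) hA
      by_cases hin : i < n
      · exact hmax i (Finset.mem_sdiff.2 ⟨Finset.mem_range.2 hin, hi⟩)
      · simp [ha i (not_lt.1 hin)]

/-! ### Sums of functions in `Exp L^q` -/

/-- The left side exceeds `1` only for `u^q > k`, and there `e^{u^q - k}` dominates it. -/
lemma div_rpow_le_expYoung {q : ℝ} (hq : 1 ≤ q) {k : ℕ} (hk : 1 ≤ k) {u : ℝ} (hu : 0 ≤ u) :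
    u / (k : ℝ) ^ (1 / q) ≤ 3 + Real.exp (-k) * expYoung q u := by
  have hk' : (1 : ℝ) ≤ k := by exact_mod_cast hk
  have hk0 : (0 : ℝ) < k := by linarith
  have hv : 0 ≤ u ^ q := by positivity
  have h1 : u / (k : ℝ) ^ (1 / q) ≤ 1 + u ^ q / k := by
    have e : (u / (k : ℝ) ^ (1 / q)) ^ q = u ^ q / k := by
      rw [Real.div_rpow hu (by positivity), ← Real.rpow_mul hk0.le, one_div,
        inv_mul_cancel₀ (by linarith), Real.rpow_one]
    rw [← e]
    have hx : 0 ≤ u / (k : ℝ) ^ (1 / q) := by positivity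
    rcases le_total (u / (k : ℝ) ^ (1 / q)) 1 with h | h
    · have : 0 ≤ (u / (k : ℝ) ^ (1 / q)) ^ q := by positivity
      linarith
    · have := Real.self_le_rpow_of_one_le h hq
      linarith
  have h2 : u ^ q / k ≤ 1 + Real.exp (u ^ q - k) := by
    have h3 := Real.add_one_le_exp (u ^ q - k)
    have h4 := Real.exp_pos (u ^ q - k)
    rw [div_le_iff₀ hk0]
    nlinarith
  have h5 : Real.exp (-k) * expYoung q u = Real.exp (u ^ q - k) - Real.exp (-k) := by
    rw [expYoung, mul_sub, ← Real.exp_add, mul_one, neg_add_eq_sub]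
  have h6 : Real.exp (-k : ℝ) ≤ 1 := Real.exp_le_one_iff.2 (by linarith)
  linarith

lemma expYoung_nonneg {q u : ℝ} (hu : 0 ≤ u) : 0 ≤ expYoung q u := by
  rw [expYoung, sub_nonneg]
  exact Real.one_le_exp (by positivity)

lemma coeFn_sum_ae {ι : Type*} (A : Finset ι) (c : ι → ℝ) (f : ι → L0) :
    ∀ᵐ t : I, (∑ i ∈ A, c i • f i : L0) t = ∑ i ∈ A, c i * f i t := by
  classical
  induction A using Finset.induction_on with
  | empty => exact AEEqFun.coeFn_zero (α := I) (β := ℝ) (μ := volume)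
  | insert j A hj ih =>
    rw [Finset.sum_insert hj]
    filter_upwards [ih, AEEqFun.coeFn_add (c j • f j) (∑ i ∈ A, c i • f i),
      AEEqFun.coeFn_smul (c j) (f j)] with t h1 h2 h3
    rw [h2, Pi.add_apply, h3, h1, Finset.sum_insert hj, Pi.smul_apply, smul_eq_mul]

/-- If all `2^|A|` signed sums of the `f i` have Luxemburg norm at most `l`, then
`∫ N_q(∑ |f i| / l) ≤ 2^|A|`, as `∑ |f i|` is pointwise one of the signed sums; the exponential
growth of `N_q` turns this into a bound of order `|A|^{1/q}` for `∫ ∑ |f i|`. -/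
lemma sum_lintegral_enorm_le {q : ℝ} (hq : 1 ≤ q) {ι : Type*} [DecidableEq ι] (A : Finset ι)
    (f : ι → L0) {l : ℝ} (hl : 0 < l) {k : ℕ} (hk : 1 ≤ k) (hA : A.card ≤ k)
    (h : ∀ B ⊆ A, l ∈ luxemburgSet (expYoung q)
      (∑ i ∈ A, (if i ∈ B then (1 : ℝ) else -1) • f i)) :
    ∑ i ∈ A, ∫⁻ t : I, ‖f i t‖ₑ ≤ ENNReal.ofReal (4 * l * (k : ℝ) ^ (1 / q)) := by
  set g : Finset ι → L0 := fun B => ∑ i ∈ A, (if i ∈ B then (1 : ℝ) else -1) • f i with hg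
  have hM : 0 < (k : ℝ) ^ (1 / q) := by
    have : (0 : ℝ) < k := by exact_mod_cast hk
    positivity
  have hpt : ∀ᵐ t : I, ∑ i ∈ A, ‖f i t‖ₑ ≤ ENNReal.ofReal (l * (k : ℝ) ^ (1 / q)) *
      (3 + ENNReal.ofReal (Real.exp (-k)) *
        ∑ B ∈ A.powerset, ENNReal.ofReal (expYoung q (|g B t| / l))) := by
    filter_upwards [(Filter.eventually_all_finset A.powerset).2 fun B _ =>
      coeFn_sum_ae A (fun i => if i ∈ B then (1 : ℝ) else -1) f] with t ht
    set B₀ := A.filter fun i => 0 ≤ f i t with hB₀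
    have hmem : B₀ ∈ A.powerset := Finset.mem_powerset.2 (Finset.filter_subset _ _)
    have hS : g B₀ t = ∑ i ∈ A, |f i t| := by
      rw [hg]
      refine (ht B₀ hmem).trans (Finset.sum_congr rfl fun i hi => ?_)
      by_cases h0 : 0 ≤ f i t
      · simp [hB₀, hi, h0, abs_of_nonneg]
      · simp [hB₀, h0, abs_of_neg (not_le.1 h0)]
    have hS0 : 0 ≤ ∑ i ∈ A, |f i t| := Finset.sum_nonneg fun _ _ => abs_nonneg _
    have hu : 0 ≤ |g B₀ t| / l := by positivity
    have hsum : ∑ i ∈ A, ‖f i t‖ₑ = ENNReal.ofReal (|g B₀ t|) := by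
      rw [hS, abs_of_nonneg hS0, ENNReal.ofReal_sum_of_nonneg fun _ _ => abs_nonneg _]
      exact Finset.sum_congr rfl fun i _ => Real.enorm_eq_ofReal_abs _
    calc ∑ i ∈ A, ‖f i t‖ₑ = ENNReal.ofReal (l * (k : ℝ) ^ (1 / q)) *
          ENNReal.ofReal (|g B₀ t| / l / (k : ℝ) ^ (1 / q)) := by
          rw [hsum, ← ENNReal.ofReal_mul (by positivity)]
          congr 1
          field_simp
      _ ≤ ENNReal.ofReal (l * (k : ℝ) ^ (1 / q)) * (3 + ENNReal.ofReal (Real.exp (-k)) *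
          ENNReal.ofReal (expYoung q (|g B₀ t| / l))) := by
          gcongr
          refine (ENNReal.ofReal_le_ofReal (div_rpow_le_expYoung hq hk hu)).trans ?_
          rw [ENNReal.ofReal_add (by norm_num) (mul_nonneg (Real.exp_pos _).le
            (expYoung_nonneg hu)), ENNReal.ofReal_mul (Real.exp_pos _).le, ENNReal.ofReal_ofNat]
      _ ≤ _ := by
          gcongr
          exact Finset.single_le_sum
            (f := fun B => ENNReal.ofReal (expYoung q (|g B t| / l))) (fun _ _ => bot_le) hmem
  have hmeas : ∀ B, AEMeasurable (fun t : I => ENNReal.ofReal (expYoung q (|g B t| / l))) volume :=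
    fun B => (measurable_young (expYoung_monotoneOn hq) hl).comp_aemeasurable (g B).aemeasurable
  have hint : ENNReal.ofReal (Real.exp (-k)) *
      ∫⁻ t : I, ∑ B ∈ A.powerset, ENNReal.ofReal (expYoung q (|g B t| / l)) ≤ 1 := by
    rw [lintegral_finsetSum' _ fun B _ => hmeas B]
    calc ENNReal.ofReal (Real.exp (-k)) *
          ∑ B ∈ A.powerset, ∫⁻ t : I, ENNReal.ofReal (expYoung q (|g B t| / l))
        ≤ ENNReal.ofReal (Real.exp (-k)) * ∑ B ∈ A.powerset, 1 := by
          gcongr with B hB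
          exact (h B (Finset.mem_powerset.1 hB)).2
      _ = ENNReal.ofReal (Real.exp (-k) * 2 ^ A.card) := by
          rw [ENNReal.ofReal_mul (Real.exp_pos _).le]
          simp
      _ ≤ 1 := by
          rw [ENNReal.ofReal_le_one, Real.exp_neg, inv_mul_le_one₀ (Real.exp_pos _)]
          calc (2 : ℝ) ^ A.card ≤ 2 ^ k := pow_le_pow_right₀ one_le_two hA
            _ ≤ (Real.exp 1) ^ k := by
              gcongr
              linarith [Real.add_one_le_exp (1 : ℝ)]
            _ = Real.exp k := by rw [← Real.exp_nat_mul, mul_one]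
  calc ∑ i ∈ A, ∫⁻ t : I, ‖f i t‖ₑ = ∫⁻ t : I, ∑ i ∈ A, ‖f i t‖ₑ :=
        (lintegral_finsetSum' _ fun i _ => (f i).aemeasurable.enorm).symm
    _ ≤ ∫⁻ t : I, ENNReal.ofReal (l * (k : ℝ) ^ (1 / q)) *
        (3 + ENNReal.ofReal (Real.exp (-k)) *
        ∑ B ∈ A.powerset, ENNReal.ofReal (expYoung q (|g B t| / l))) := lintegral_mono_ae hpt
    _ = ENNReal.ofReal (l * (k : ℝ) ^ (1 / q)) * (3 + ENNReal.ofReal (Real.exp (-k)) *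
        ∫⁻ t : I, ∑ B ∈ A.powerset, ENNReal.ofReal (expYoung q (|g B t| / l))) := by
        rw [lintegral_const_mul' _ _ ENNReal.ofReal_ne_top, lintegral_add_left measurable_const,
          lintegral_const_mul' _ _ ENNReal.ofReal_ne_top]
        simp
    _ ≤ ENNReal.ofReal (l * (k : ℝ) ^ (1 / q)) * (3 + 1) := by gcongr
    _ = ENNReal.ofReal (4 * l * (k : ℝ) ^ (1 / q)) := by
        rw [mul_assoc, ENNReal.ofReal_mul (by norm_num : (0 : ℝ) ≤ 4), ENNReal.ofReal_ofNat,
          mul_comm]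
        norm_num

noncomputable section

/-! ### The inclusion of `Exp L^q` in `L^1` -/

lemma ExpL.mem_Lp_one {q : ℝ} {hq : 1 ≤ q} (f : ExpL q hq) :
    (f : L0) ∈ Lp ℝ 1 (volume : Measure I) := by
  obtain ⟨l, hl⟩ := f.2
  have h := sum_lintegral_enorm_le hq ({()} : Finset Unit) (fun _ => (f : L0)) hl.1 le_rfl le_rfl
    (fun B _ => by
      refine ⟨hl.1, le_of_eq_of_le (lintegral_congr_ae ?_) hl.2⟩
      rw [Finset.sum_singleton]
      filter_upwards [AEEqFun.coeFn_smul (if () ∈ B then (1 : ℝ) else -1) (f : L0)] with t ht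
      rw [ht, Pi.smul_apply, smul_eq_mul, abs_mul]
      split_ifs <;> simp)
  rw [Finset.sum_singleton] at h
  rw [Lp.mem_Lp_iff_eLpNorm_lt_top, eLpNorm_one_eq_lintegral_enorm]
  exact h.trans_lt ENNReal.ofReal_lt_top

/-- The inclusion `Exp L^q ⊂ L^1`. -/
def ExpL.toL1 (q : ℝ) (hq : 1 ≤ q) : ExpL q hq →ₗ[ℝ] L1 where
  toFun f := ⟨f, ExpL.mem_Lp_one f⟩
  map_add' _ _ := rfl
  map_smul' _ _ := rfl

lemma ExpL.isAbsSumming_toL1 {p q : ℝ} (hq : 1 ≤ q) (hpq : 1 / p + 1 / q = 1) :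
    IsAbsSumming (weakLpNorm p) 1 (ExpL.toL1 q hq) := by
  refine ⟨4, by norm_num, fun n x => ?_⟩
  set w : ℝ≥0∞ := ⨆ φ ∈ dualBall (ExpL q hq),
    ENNReal.ofReal ((∑ i ∈ Finset.range n, |φ (x i)| ^ (1 : ℝ)) ^ (1 / (1 : ℝ))) with hw
  have hwtop : w ≠ ∞ := by
    refine ne_top_of_le_ne_top (ENNReal.ofReal_ne_top (r := ∑ i ∈ Finset.range n, ‖x i‖))
      (iSup₂_le fun φ hφ => ENNReal.ofReal_le_ofReal ?_)
    simp only [Real.rpow_one, div_one]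
    exact Finset.sum_le_sum fun i _ => hφ (x i)
  have hφw : ∀ φ ∈ dualBall (ExpL q hq), ∑ i ∈ Finset.range n, |φ (x i)| ≤ w.toReal := by
    intro φ hφ
    rw [← ENNReal.ofReal_le_iff_le_toReal hwtop]
    refine le_of_eq_of_le ?_ (le_iSup₂ (f := fun φ (_ : φ ∈ dualBall (ExpL q hq)) =>
      ENNReal.ofReal ((∑ i ∈ Finset.range n, |φ (x i)| ^ (1 : ℝ)) ^ (1 / (1 : ℝ)))) φ hφ)
    simp
  -- The signed sums of the `x i` have norm at most `w`, by Hahn--Banach.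
  have hsign : ∀ A ⊆ Finset.range n, ∀ B ⊆ A, ∀ l, w.toReal < l → l ∈ luxemburgSet (expYoung q)
      (∑ i ∈ A, (if i ∈ B then (1 : ℝ) else -1) • (x i : L0)) := by
    intro A hA B _ l hl
    have e : (∑ i ∈ A, (if i ∈ B then (1 : ℝ) else -1) • (x i : L0)) =
        ((∑ i ∈ A, (if i ∈ B then (1 : ℝ) else -1) • x i : ExpL q hq) : L0) := by
      push_cast; rfl
    rw [e]
    refine mem_luxemburgSet_of_lt (expYoung_monotoneOn hq)
      (∑ i ∈ A, (if i ∈ B then (1 : ℝ) else -1) • x i : ExpL q hq).2 (lt_of_le_of_lt ?_ hl)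
    obtain ⟨φ, hφ, hle⟩ := ExpL.exists_dualBall_eq_norm
      (∑ i ∈ A, (if i ∈ B then (1 : ℝ) else -1) • x i)
    refine hle.trans ?_
    rw [map_sum]
    calc ∑ i ∈ A, φ ((if i ∈ B then (1 : ℝ) else -1) • x i) ≤ ∑ i ∈ A, |φ (x i)| := by
          refine Finset.sum_le_sum fun i _ => ?_
          rw [map_smul]
          split_ifs
          · simpa using le_abs_self _
          · simpa using neg_le_abs _
      _ ≤ ∑ i ∈ Finset.range n, |φ (x i)| :=
          Finset.sum_le_sum_of_subset_of_nonneg hA fun _ _ _ => abs_nonneg _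
      _ ≤ w.toReal := hφw φ hφ
  refine iSup₂_le fun k hk => ?_
  have hk0 : (0 : ℝ) < k := by exact_mod_cast hk
  obtain ⟨A, hAn, hAk, hA⟩ := exists_sum_rearr_count_le
    (fun i => if i < n then ‖ExpL.toL1 q hq (x i)‖ else 0) n
    (fun i hi => by simp [not_lt.2 hi]) k
  have hbound : ∀ l, w.toReal < l →
      ∑ i ∈ Finset.Icc 1 k, rearr (Measure.count : Measure ℕ)
        (fun i => if i < n then ‖ExpL.toL1 q hq (x i)‖ else 0) (i : ℝ≥0∞) ≤
      ENNReal.ofReal (4 * l * (k : ℝ) ^ (1 / q)) := by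
    intro l hl
    refine hA.trans (le_of_eq_of_le (Finset.sum_congr rfl fun i hi => ?_)
      (sum_lintegral_enorm_le hq A (fun i => (x i : L0))
        (ENNReal.toReal_nonneg.trans_lt hl) hk hAk fun B hB => hsign A hAn B hB l hl))
    rw [if_pos (Finset.mem_range.1 (hAn hi)), enorm_norm, Lp.enorm_def,
      eLpNorm_one_eq_lintegral_enorm]
    rfl
  have hlim : Filter.Tendsto (fun l : ℝ => ENNReal.ofReal (4 * l * (k : ℝ) ^ (1 / q)))
      (nhdsWithin w.toReal (Ioi w.toReal))
      (nhds (ENNReal.ofReal (4 * w.toReal * (k : ℝ) ^ (1 / q)))) :=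
    ((ENNReal.continuous_ofReal.comp (by fun_prop)).tendsto w.toReal).mono_left nhdsWithin_le_nhds
  have hbound' := ge_of_tendsto hlim (Filter.eventually_of_mem self_mem_nhdsWithin hbound)
  calc (k : ℝ≥0∞) ^ (1 / p - 1) * _
      ≤ (k : ℝ≥0∞) ^ (1 / p - 1) * ENNReal.ofReal (4 * w.toReal * (k : ℝ) ^ (1 / q)) := by
        gcongr
    _ = ENNReal.ofReal 4 * w := by
        have e : (k : ℝ≥0∞) ^ (1 / p - 1) = ENNReal.ofReal ((k : ℝ) ^ (1 / p - 1)) := by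
          rw [← ENNReal.ofReal_rpow_of_pos hk0, ENNReal.ofReal_natCast]
        have e2 : (k : ℝ) ^ (1 / p - 1) * (k : ℝ) ^ (1 / q) = 1 := by
          rw [← Real.rpow_add hk0, show 1 / p - 1 + 1 / q = 0 by linarith, Real.rpow_zero]
        rw [e, ← ENNReal.ofReal_mul (by positivity), mul_comm (4 * w.toReal), ← mul_assoc, e2,
          one_mul, ENNReal.ofReal_mul (by norm_num), ENNReal.ofReal_toReal hwtop]

lemma IsAbsSumming.comp {E : (ℕ → ℝ) → ℝ≥0∞} {X Z Y : Type*} [AddCommGroup X] [Module ℝ X]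
    [Norm X] [AddCommGroup Z] [Module ℝ Z] [Norm Z] [NormedAddCommGroup Y] [NormedSpace ℝ Y]
    {T : X →ₗ[ℝ] Y} (hT : IsAbsSumming E 1 T) (S : Z →ₗ[ℝ] X) {D : ℝ} (hD : 0 < D)
    (hS : ∀ z, ‖S z‖ ≤ D * ‖z‖) : IsAbsSumming E 1 (T ∘ₗ S) := by
  obtain ⟨C, hC, h⟩ := hT
  refine ⟨C * D, mul_pos hC hD, fun n z => (h n fun i => S (z i)).trans ?_⟩
  rw [ENNReal.ofReal_mul hC.le, mul_assoc]
  gcongr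
  refine iSup₂_le fun φ hφ => ?_
  have hmem : D⁻¹ • (φ ∘ₗ S) ∈ dualBall Z := fun z => by
    rw [LinearMap.smul_apply, smul_eq_mul, abs_mul, abs_of_pos (inv_pos.2 hD),
      inv_mul_le_iff₀ hD]
    exact (hφ (S z)).trans (hS z)
  refine le_of_eq_of_le ?_ (mul_le_mul_right (le_iSup₂ (f := fun φ (_ : φ ∈ dualBall Z) =>
    ENNReal.ofReal ((∑ i ∈ Finset.range n, |φ (z i)| ^ (1 : ℝ)) ^ (1 / (1 : ℝ))))
    (D⁻¹ • (φ ∘ₗ S)) hmem) (ENNReal.ofReal D))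
  rw [← ENNReal.ofReal_mul hD.le]
  simp only [Real.rpow_one, div_one, LinearMap.smul_apply, LinearMap.comp_apply, smul_eq_mul,
    abs_mul, abs_of_pos (inv_pos.2 hD), Finset.mul_sum, mul_inv_cancel_left₀ hD.ne']

/-! ### The inclusion of `X_p` in `Exp L^q` -/

lemma rearr_le_of_lorentzENorm_le {p q : ℝ} (hp : 1 < p) (hpq : 1 / p + 1 / q = 1) {f : L0}
    {N : ℝ} (hN : 0 ≤ N) (hf : lorentzENorm p (lorentzWeight p hp) f ≤ ENNReal.ofReal N)
    {t : ℝ} (ht : 0 < t) (ht1 : t ≤ 1) :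
    rearr (volume : Measure I) f (ENNReal.ofReal t) ≤
      ENNReal.ofReal (N * Real.log (Real.exp 1 / t) ^ (1 / q)) := by
  have hp0 : 0 < p := by linarith
  have hL := lorentzWeight_log ht
  rw [min_eq_left ht1] at hL
  set L := Real.log (Real.exp 1 / t) with hLdef
  set r := rearr (volume : Measure I) f (ENNReal.ofReal t) with hr
  have hL0 : 0 < L := by linarith
  have hWm : (lorentzWeight p hp).measure (Ioc 0 t) = ENNReal.ofReal (L ^ (1 - p)) := by
    rw [StieltjesFunction.measure_Ioc]
    change ENNReal.ofReal (lorentzWeightFun p t - lorentzWeightFun p 0) = _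
    simp [lorentzWeightFun, ht.not_ge, min_eq_left ht1, hLdef]
  have h1 : r ^ p * ENNReal.ofReal (L ^ (1 - p)) ≤ ENNReal.ofReal N ^ p := by
    calc r ^ p * ENNReal.ofReal (L ^ (1 - p))
        = ∫⁻ _ in Ioc (0 : ℝ) t, r ^ p ∂(lorentzWeight p hp).measure := by
          rw [setLIntegral_const, hWm]
      _ ≤ ∫⁻ s in Ioc (0 : ℝ) t, rearr (volume : Measure I) f (ENNReal.ofReal s) ^ p
            ∂(lorentzWeight p hp).measure :=
          setLIntegral_mono' measurableSet_Ioc fun s hs => ENNReal.rpow_le_rpow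
            (rearr_antitone _ _ (ENNReal.ofReal_le_ofReal hs.2)) hp0.le
      _ ≤ ∫⁻ s in Ioc (0 : ℝ) 1, rearr (volume : Measure I) f (ENNReal.ofReal s) ^ p
            ∂(lorentzWeight p hp).measure :=
          lintegral_mono_set (Ioc_subset_Ioc_right ht1)
      _ ≤ ENNReal.ofReal N ^ p := by
          rwa [lorentzENorm, one_div, ENNReal.rpow_inv_le_iff hp0] at hf
  have h2 : r ^ p ≤ ENNReal.ofReal (N * L ^ (1 / q)) ^ p := by
    have e : ENNReal.ofReal (N * L ^ (1 / q)) ^ p =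
        ENNReal.ofReal N ^ p * ENNReal.ofReal (L ^ (p - 1)) := by
      rw [ENNReal.ofReal_mul hN, ENNReal.mul_rpow_of_nonneg _ _ hp0.le,
        ENNReal.ofReal_rpow_of_nonneg (x := L ^ (1 / q)) (by positivity) hp0.le, ← Real.rpow_mul hL0.le,
        show 1 / q * p = p - 1 by
          rw [show 1 / q = 1 - 1 / p by linarith]; field_simp]
    have e2 : ENNReal.ofReal (L ^ (1 - p)) * ENNReal.ofReal (L ^ (p - 1)) = 1 := by
      rw [← ENNReal.ofReal_mul (by positivity), ← Real.rpow_add hL0]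
      simp
    rw [e]
    calc r ^ p = r ^ p * ENNReal.ofReal (L ^ (1 - p)) * ENNReal.ofReal (L ^ (p - 1)) := by
          rw [mul_assoc, e2, mul_one]
      _ ≤ _ := by gcongr
  exact (ENNReal.rpow_le_rpow_iff hp0).1 h2

/-- For `L ≥ 1` this is the bound on `f^*(t)` at `t = e^{1 - L}`, where `ln(e/t) = L`; for `L < 1`
it is trivial. The strict inequality `‖f‖ < N` makes up for the infimum in `f^*`. -/
lemma volume_lt_rpow_le {p q : ℝ} (hp : 1 < p) (hq : 1 < q) (hpq : 1 / p + 1 / q = 1) {f : L0}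
    {N : ℝ} (hN : 0 < N) (hf : lorentzENorm p (lorentzWeight p hp) f < ENNReal.ofReal N)
    (L : ℝ) :
    (volume : Measure I) {x | L < (|f x| / N) ^ q} ≤ ENNReal.ofReal (Real.exp (1 - L)) := by
  rcases lt_or_ge L 1 with hL | hL
  · refine prob_le_one.trans ?_
    rw [ENNReal.one_le_ofReal]
    exact Real.one_le_exp (by linarith)
  have hL0 : 0 < L := by linarith
  have hlog : Real.log (Real.exp 1 / Real.exp (1 - L)) = L := by
    rw [← Real.exp_sub, Real.log_exp]; ring
  obtain ⟨M, hfM, hMN⟩ := exists_between hf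
  have hMtop : M ≠ ∞ := ne_top_of_lt hMN
  have hr := rearr_le_of_lorentzENorm_le hp hpq (N := M.toReal) ENNReal.toReal_nonneg
    (by rw [ENNReal.ofReal_toReal hMtop]; exact hfM.le) (Real.exp_pos (1 - L))
    (Real.exp_le_one_iff.2 (by linarith))
  rw [hlog] at hr
  have hMN' : M.toReal < N := by rwa [← ENNReal.lt_ofReal_iff_toReal_lt hMtop]
  have hlt := hr.trans_lt ((ENNReal.ofReal_lt_ofReal_iff (by positivity)).2
    (mul_lt_mul_of_pos_right hMN' (by positivity : 0 < L ^ (1 / q))))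
  obtain ⟨l, ⟨-, hl⟩, hlN⟩ := sInf_lt_iff.1 hlt
  refine (measure_mono fun x (hx : L < (|f x| / N) ^ q) => ?_).trans hl.le
  refine hlN.trans ?_
  rw [Real.enorm_eq_ofReal_abs, ENNReal.ofReal_lt_ofReal_iff_of_nonneg (by positivity),
    mul_comm, ← lt_div_iff₀ hN, one_div, Real.rpow_inv_lt_iff_of_pos hL0.le (by positivity)
    (by linarith)]
  exact hx

/-- The tail bound `m {V > L} ≤ e^{1 - L}` makes `V / 4` exponentially integrable. -/
lemma lintegral_exp_div_four_sub_one_le {Ω : Type*} [MeasurableSpace Ω] {μ : Measure Ω}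
    {V : Ω → ℝ} (hV0 : ∀ x, 0 ≤ V x) (hV : AEMeasurable V μ)
    (hμ : ∀ L, μ {x | L < V x} ≤ ENNReal.ofReal (Real.exp (1 - L))) :
    ∫⁻ x, ENNReal.ofReal (Real.exp (V x / 4) - 1) ∂μ ≤ 1 := by
  have hprim : ∀ v : ℝ, ∫ s in (0 : ℝ)..v, Real.exp (s / 4) / 4 = Real.exp (v / 4) - 1 := by
    intro v
    rw [intervalIntegral.integral_eq_sub_of_hasDerivAt (f := fun s => Real.exp (s / 4))]
    · simp
    · intro s _
      simpa [div_eq_mul_inv] using ((hasDerivAt_id s).div_const 4).exp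
    · exact (by fun_prop : Continuous fun s : ℝ => Real.exp (s / 4) / 4).intervalIntegrable _ _
  have hlc := lintegral_comp_eq_lintegral_meas_lt_mul μ (f := V)
    (g := fun s => Real.exp (s / 4) / 4) (Filter.Eventually.of_forall hV0) hV
    (fun t _ => (by fun_prop : Continuous fun s : ℝ => Real.exp (s / 4) / 4).intervalIntegrable _ _)
    (Filter.Eventually.of_forall fun s => by positivity)
  simp only [hprim] at hlc
  rw [hlc]
  have hint : IntegrableOn (fun s : ℝ => Real.exp 1 / 4 * Real.exp (-(3 / 4) * s)) (Ioi 0) :=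
    (integrableOn_exp_mul_Ioi (by norm_num) 0).const_mul _
  calc ∫⁻ s in Ioi (0 : ℝ), μ {x | s < V x} * ENNReal.ofReal (Real.exp (s / 4) / 4)
      ≤ ∫⁻ s in Ioi (0 : ℝ), ENNReal.ofReal (Real.exp 1 / 4 * Real.exp (-(3 / 4) * s)) := by
        refine lintegral_mono fun s => ?_
        refine (mul_le_mul_left (hμ s) _).trans (le_of_eq ?_)
        rw [← ENNReal.ofReal_mul (Real.exp_pos _).le, div_mul_eq_mul_div, ← mul_div_assoc,
          ← Real.exp_add, ← Real.exp_add]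
        ring_nf
    _ = ENNReal.ofReal (∫ s in Ioi (0 : ℝ), Real.exp 1 / 4 * Real.exp (-(3 / 4) * s)) :=
        (ofReal_integral_eq_lintegral_ofReal hint
          (Filter.Eventually.of_forall fun s => by positivity)).symm
    _ ≤ 1 := by
        rw [integral_const_mul, integral_exp_mul_Ioi (by norm_num), ENNReal.ofReal_le_one]
        have := Real.exp_one_lt_d9
        norm_num
        linarith

lemma mem_luxemburgSet_of_lorentzENorm_lt {p q : ℝ} (hp : 1 < p) (hq : 1 < q)
    (hpq : 1 / p + 1 / q = 1) {f : L0} {N : ℝ} (hN : 0 < N)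
    (hf : lorentzENorm p (lorentzWeight p hp) f < ENNReal.ofReal N) :
    (4 : ℝ) ^ (1 / q) * N ∈ luxemburgSet (expYoung q) f := by
  refine ⟨by positivity, le_of_eq_of_le (lintegral_congr fun t => ?_)
    (lintegral_exp_div_four_sub_one_le (V := fun x : I => (|f x| / N) ^ q)
      (fun x => by positivity) (by
        have := f.aemeasurable
        fun_prop)
      (volume_lt_rpow_le hp hq hpq hN hf))⟩
  rw [expYoung, mul_comm, ← div_div, Real.div_rpow (by positivity) (by positivity),
    ← Real.rpow_mul (by norm_num), one_div, inv_mul_cancel₀ (by linarith), Real.rpow_one]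

section XSpace

variable {p q : ℝ} {hp : 1 < p}

lemma XSpace.lorentzENorm_lt (f : XSpace p hp) {N : ℝ} (hN : ‖f‖ < N) :
    lorentzENorm p (lorentzWeight p hp) f < ENNReal.ofReal N := by
  rw [ENNReal.lt_ofReal_iff_toReal_lt f.2]
  exact hN

lemma XSpace.norm_nonneg (f : XSpace p hp) : 0 ≤ ‖f‖ := ENNReal.toReal_nonneg

lemma XSpace_le_ExpL (hq : 1 < q) (hpq : 1 / p + 1 / q = 1) : XSpace p hp ≤ ExpL q hq.le :=
  fun f hf => ⟨_, mem_luxemburgSet_of_lorentzENorm_lt hp hq hpq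
    (N := ‖(⟨f, hf⟩ : XSpace p hp)‖ + 1) (by linarith [XSpace.norm_nonneg ⟨f, hf⟩])
    (XSpace.lorentzENorm_lt ⟨f, hf⟩ (lt_add_one _))⟩

lemma XSpace.norm_inclusion_le (hq : 1 < q) (hpq : 1 / p + 1 / q = 1) (f : XSpace p hp) :
    ‖Submodule.inclusion (XSpace_le_ExpL hq hpq) f‖ ≤ (4 : ℝ) ^ (1 / q) * ‖f‖ := by
  have h4 : (0 : ℝ) < 4 ^ (1 / q) := by positivity
  rw [mul_comm, ← div_le_iff₀ h4]
  refine le_of_forall_gt_imp_ge_of_dense fun N hN => ?_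
  rw [div_le_iff₀ h4, mul_comm]
  exact luxemburgNorm_le (mem_luxemburgSet_of_lorentzENorm_lt hp hq hpq
    ((XSpace.norm_nonneg f).trans_lt hN) (XSpace.lorentzENorm_lt f hN))

end XSpace

end

theorem corollary5 (p q : ℝ) (hp : 1 < p) (hp2 : p < 2) (hpq : p.HolderConjugate q) :
    (∃ T : ExpL q hpq.symm.lt.le →ₗ[ℝ] L1,
      (∀ f, ((T f : L1) : L0) = (f : L0)) ∧ IsAbsSumming (weakLpNorm p) 1 T) ∧
    (∃ T : XSpace p hp →ₗ[ℝ] L1,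
      (∀ f, ((T f : L1) : L0) = (f : L0)) ∧ IsAbsSumming (weakLpNorm p) 1 T) := by
  have hq : 1 < q := hpq.symm.lt
  have h1 : 1 / p + 1 / q = 1 := by simpa using hpq.inv_add_inv_eq_one
  have hsum := ExpL.isAbsSumming_toL1 hq.le h1
  exact ⟨⟨_, fun _ => rfl, hsum⟩, ⟨_, fun _ => rfl,
    hsum.comp (Submodule.inclusion (XSpace_le_ExpL (hp := hp) hq h1)) (D := (4 : ℝ) ^ (1 / q))
      (by positivity) (XSpace.norm_inclusion_le hq h1)⟩⟩
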